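/- Let $T_j=j(j+1)/2$ and $(q)_N=\prod_{j=1}^{N}(1-q^j)$. For integers $N,n$ let $$\begin{bmatrix}N\\n\end{bmatrix}=\frac{(q)_N}{(q)_n\,(q)_{N-n}}\quad\text{if } n\ge 0 \text{ and } N-n\ge 0,\qquad \begin{bmatrix}N\\n\end{bmatrix}=0\quad\text{otherwise};$$ this is a polynomial in $q$. Then for every integer $L\ge 0$ the following identity of polynomials in $q$ and $z$ holds (equivalently, it holds for all elements $q,z$ of any commutative $\mathbb{Q}$-algebra): $$\sum_{i,j\ge 0} q^{T_i+T_j}(-z^2)^j\begin{bmatrix}L-j\\i\end{bmatrix}\begin{bmatrix}i\\j\end{bmatrix}=\sum_{i,j,k\ge 0}(-1)^j z^{i+j}q^{T_i+T_j+T_k}\begin{bmatrix}L-i\\j\end{bmatrix}\begin{bmatrix}L-j\\k\end{bmatrix}\begin{bmatrix}L-k\\i\end{bmatrix},$$ where both sums have only finitely many nonzero terms. -/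

import Mathlib

open Polynomial

/-- The `q`-Pochhammer symbol `(a; q)_N = ∏_{j=0}^{N-1} (1 - a q^j)`. -/
def qPochhammer {R : Type*} [CommRing R] (a q : R) (N : ℕ) : R :=
  ∏ j ∈ Finset.range N, (1 - a * q ^ j)

/-- The triangular number `T_j = j (j + 1) / 2` (the division is exact). -/
def triangular (j : ℕ) : ℕ := j * (j + 1) / 2

/-- The `q`-binomial coefficient `[N choose n]` as a polynomial in the indeterminate `q = X`:
it is `(q; q)_N / ((q; q)_n (q; q)_{N-n})` if `n ≥ 0` and `N - n ≥ 0`, and `0` otherwise.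
The arguments are integers, so that no subtraction is truncated; the quotient in `ℚ[X]`
is exact by `qBinomialPoly_mul` below. -/
noncomputable def qBinomialPoly (N n : ℤ) : ℚ[X] :=
  if 0 ≤ n ∧ 0 ≤ N - n then
    qPochhammer (X : ℚ[X]) X N.toNat /
      (qPochhammer (X : ℚ[X]) X n.toNat * qPochhammer (X : ℚ[X]) X (N - n).toNat)
  else 0

/-- The value of the `q`-binomial coefficient `[N choose n]` at an element `q` of a
commutative `ℚ`-algebra (for instance a complex number, or an indeterminate). -/
noncomputable def qBinomial {R : Type*} [CommRing R] [Algebra ℚ R] (q : R) (N n : ℤ) : R :=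
  aeval q (qBinomialPoly N n)

theorem qPochhammer_mul_dvd {R : Type*} [CommRing R] (q : R) (n m : ℕ) :
    qPochhammer q q n * qPochhammer q q m ∣ qPochhammer q q (n + m) := by
  have succ : ∀ k, qPochhammer q q (k + 1) = qPochhammer q q k * (1 - q ^ (k + 1)) := by
    intro k
    simp [qPochhammer, Finset.prod_range_succ, pow_succ']
  induction n generalizing m with
  | zero => simp [qPochhammer]
  | succ n ihn =>
    induction m with
    | zero => simp [qPochhammer]
    | succ m ihm =>
      have h1 := ihn (m + 1)
      have e : n + 1 + (m + 1) = (n + 1 + m) + 1 := by ring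
      have e' : n + (m + 1) = n + 1 + m := by ring
      rw [e'] at h1
      have h2 := ihm
      rw [e, succ (n + 1 + m)]
      have key : (1 - q ^ (n + 1 + m + 1)) =
          (1 - q ^ (n + 1)) + q ^ (n + 1) * (1 - q ^ (m + 1)) := by ring
      rw [key, mul_add]
      refine dvd_add ?_ ?_
      · rw [succ n, mul_right_comm]
        exact mul_dvd_mul_right h1 _
      · rw [succ m, ← mul_assoc, mul_left_comm, mul_comm (q ^ (n + 1))]
        exact Dvd.dvd.mul_right (mul_dvd_mul_right h2 _) _

/-- The division in the definition of the `q`-binomial coefficients is exact. -/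
theorem qBinomialPoly_mul (n m : ℕ) :
    qBinomialPoly ((n : ℤ) + m) n * (qPochhammer (X : ℚ[X]) X n * qPochhammer (X : ℚ[X]) X m) =
      qPochhammer (X : ℚ[X]) X (n + m) := by
  have h1 : ((n : ℤ) + m).toNat = n + m := by omega
  have h2 : ((n : ℤ) + m - n).toNat = m := by omega
  have h3 : (0 : ℤ) ≤ n ∧ (0 : ℤ) ≤ (n : ℤ) + m - n := by omega
  rw [qBinomialPoly, if_pos h3, h1, h2, Int.toNat_natCast, mul_comm]
  refine EuclideanDomain.mul_div_cancel' ?_ (qPochhammer_mul_dvd _ n m)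
  have hne : ∀ k, qPochhammer (X : ℚ[X]) X k ≠ 0 := by
    intro k
    refine Finset.prod_ne_zero_iff.mpr fun j _ h => ?_
    have := congrArg (Polynomial.eval 0) h
    simp at this
  exact mul_ne_zero (hne n) (hne m)

/-! Compare the contributions of each power `z ^ m`. On both sides only `m ≤ L` matters; write `L =
m + d`.

On the right the coefficient is a sum over `i + j = m` and `k`. The sum over `k` is exchanged for
one over the splittings `i = n + s` (`sum_gaussBinom_mul_gaussBinom_sub`). Grouping by `t = j + s`
then lets the `q`-Vandermonde convolution absorb the remaining inner sum, leaving a single sum `S_m`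
of `foldedTerm q d n t` over `n + t = m` (`sum_cyclic_eq_sum_foldedTerm`).

Creative telescoping gives `(1 - q^(m+2)) S_(m+2) + q^(m+2) (1 - q^(m+2+2d)) S_m = 0`
(`sum_foldedTerm_add_two`). Since `S_1 = 0`, all odd coefficients vanish, and `S_0` determines the
even ones as products. On the left only even powers of `z` occur, and the `q`-binomial theorem
evaluates their coefficients to the same products (`sum_gaussBinom_mul_gaussBinom`).

Divisions by `(q)_n` take place in the fraction field of `ℚ[X]`; the resulting polynomial identities
are then specialised to arbitrary `q`. -/

/-! ### Triangular numbers and division-free Gaussian binomials. -/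

theorem triangular_succ (j : ℕ) : triangular (j + 1) = triangular j + (j + 1) := by
  unfold triangular
  rw [show (j + 1) * (j + 1 + 1) = j * (j + 1) + (j + 1) * 2 by ring,
    Nat.add_mul_div_right _ _ (by norm_num)]

theorem triangular_add (a b : ℕ) :
    triangular (a + b) = triangular a + triangular b + a * b := by
  induction b with
  | zero => simp [triangular]
  | succ b ih => rw [← add_assoc, triangular_succ, triangular_succ, ih]; ring

/-- The Gaussian binomial coefficient at an element of a commutative ring, by the `q`-Pascal
recursion. -/
def gaussBinom {R : Type*} [CommRing R] (q : R) : ℕ → ℕ → R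
  | _, 0 => 1
  | 0, _ + 1 => 0
  | n + 1, k + 1 => q ^ (k + 1) * gaussBinom q n (k + 1) + gaussBinom q n k

section Ring

variable {R : Type*} [CommRing R] (q : R)

@[simp] theorem gaussBinom_zero_right (n : ℕ) : gaussBinom q n 0 = 1 := by
  cases n <;> simp [gaussBinom]

theorem gaussBinom_succ_succ (n k : ℕ) : gaussBinom q (n + 1) (k + 1) =
    q ^ (k + 1) * gaussBinom q n (k + 1) + gaussBinom q n k := by
  simp [gaussBinom]

theorem gaussBinom_eq_zero_of_lt {n k : ℕ} (h : n < k) : gaussBinom q n k = 0 := by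
  induction n generalizing k with
  | zero => obtain ⟨k, rfl⟩ := Nat.exists_eq_succ_of_ne_zero h.ne'; simp [gaussBinom]
  | succ n ih =>
    obtain ⟨k, rfl⟩ := Nat.exists_eq_succ_of_ne_zero (Nat.ne_zero_of_lt h)
    rw [Nat.succ_eq_add_one, gaussBinom_succ_succ, ih (by omega), ih (by omega)]
    simp

@[simp] theorem gaussBinom_self (n : ℕ) : gaussBinom q n n = 1 := by
  induction n with
  | zero => simp
  | succ n ih => rw [gaussBinom_succ_succ, gaussBinom_eq_zero_of_lt q (Nat.lt_succ_self n), ih]; simp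

theorem gaussBinom_succ_succ' (n k : ℕ) (h : k ≤ n) : gaussBinom q (n + 1) (k + 1) =
    gaussBinom q n (k + 1) + q ^ (n - k) * gaussBinom q n k := by
  induction n generalizing k with
  | zero => obtain rfl : k = 0 := by omega
            simp [gaussBinom]
  | succ n ih =>
    cases k with
    | zero =>
      have h1 := ih 0 (by omega)
      have h2 := gaussBinom_succ_succ q n 0
      have h3 := gaussBinom_succ_succ q (n + 1) 0
      simp only [gaussBinom_zero_right, Nat.sub_zero, mul_one, zero_add, pow_one] at *
      rw [h3]
      linear_combination q * h1 - h2
    | succ k =>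
      rcases Nat.lt_or_ge k n with hk | hk
      · obtain ⟨e, rfl⟩ := Nat.exists_eq_add_of_lt hk
        have h1 := ih k (by omega)
        have h2 := ih (k + 1) (by omega)
        have h3 := gaussBinom_succ_succ q (k + e + 1) (k + 1)
        have h4 := gaussBinom_succ_succ q (k + e + 1) k
        have h5 := gaussBinom_succ_succ q (k + e + 1 + 1) (k + 1)
        rw [show k + e + 1 - k = e + 1 by omega] at h1
        rw [show k + e + 1 - (k + 1) = e by omega] at h2
        rw [show k + e + 1 + 1 - (k + 1) = e + 1 by omega]
        linear_combination h5 - h3 - q ^ (e + 1) * h4 + q ^ (k + 2) * h2 + h1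
      · obtain rfl : k = n := by omega
        simp [gaussBinom_eq_zero_of_lt]

/-- The dual Pascal rule without subtraction, in the shape needed for the Vandermonde induction. -/
theorem gaussBinom_add_succ (n t : ℕ) : gaussBinom q (n + 1 + t + 1) (t + 1) =
    gaussBinom q (n + t + 1) (t + 1) + q ^ (n + 1) * gaussBinom q (n + 1 + t) t := by
  rw [gaussBinom_succ_succ' q _ _ (by omega), show n + 1 + t - t = n + 1 by omega,
    show n + 1 + t = n + t + 1 by ring]

theorem qPochhammer_zero (a : R) : qPochhammer a q 0 = 1 := by simp [qPochhammer]

theorem qPochhammer_self_succ (n : ℕ) :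
    qPochhammer q q (n + 1) = qPochhammer q q n * (1 - q ^ (n + 1)) := by
  simp [qPochhammer, Finset.prod_range_succ, pow_succ']

theorem qPochhammer_neg_self_succ (n : ℕ) :
    qPochhammer (-q) q (n + 1) = qPochhammer (-q) q n * (1 + q ^ (n + 1)) := by
  simp [qPochhammer, Finset.prod_range_succ, pow_succ']

theorem qPochhammer_neg_self_add (n d : ℕ) :
    qPochhammer (-q) q (n + d) =
      qPochhammer (-q) q n * ∏ j ∈ Finset.range d, (1 + q ^ n * q ^ (j + 1)) := by
  induction d with
  | zero => simp
  | succ d ih =>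
    rw [← add_assoc, qPochhammer_neg_self_succ, ih, Finset.prod_range_succ]; ring

/-- Pascal's rule matches `1 - q^(k+e+2) = (1 - q^(k+1)) + q^(k+1) (1 - q^(e+1))`. This links the
recursion with the quotient definition. -/
theorem gaussBinom_mul_qPochhammer (k e : ℕ) :
    gaussBinom q (k + e) k * (qPochhammer q q k * qPochhammer q q e) = qPochhammer q q (k + e) := by
  induction k generalizing e with
  | zero => simp [qPochhammer_zero]
  | succ k ihk =>
    induction e with
    | zero => simp [qPochhammer_zero]
    | succ e ihe =>
      have h1 := ihk (e + 1)
      rw [show k + 1 + (e + 1) = k + (e + 1) + 1 by ring, gaussBinom_succ_succ]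
      rw [show k + 1 + e = k + (e + 1) by ring] at ihe
      rw [qPochhammer_self_succ q k, qPochhammer_self_succ q e, qPochhammer_self_succ q (k + (e + 1))] at *
      linear_combination (1 - q ^ (k + 1)) * h1 + q ^ (k + 1) * (1 - q ^ (e + 1)) * ihe

theorem map_gaussBinom {S : Type*} [CommRing S] (f : R →+* S) (n k : ℕ) :
    f (gaussBinom q n k) = gaussBinom (f q) n k := by
  induction n generalizing k with
  | zero => cases k <;> simp [gaussBinom]
  | succ n ih => cases k <;> simp [gaussBinom_succ_succ, ih]

/-! ### Summation formulas over a commutative ring. -/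

/-- The finite `q`-binomial theorem. -/
theorem sum_gaussBinom_eq_prod (x : R) (n N : ℕ) (h : n ≤ N) :
    ∑ m ∈ Finset.range (N + 1), q ^ triangular m * x ^ m * gaussBinom q n m =
      ∏ j ∈ Finset.range n, (1 + x * q ^ (j + 1)) := by
  induction n generalizing x N with
  | zero =>
    rw [Finset.sum_range_succ', Finset.sum_eq_zero]
    · simp [triangular]
    · intro m _
      simp [gaussBinom]
  | succ n ih =>
    obtain ⟨N, rfl⟩ : ∃ M, N = M + 1 := ⟨N - 1, by omega⟩
    -- Splitting off the factor `1 + x * q` leaves the product at `q * x`. Its copy multiplied by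
    -- `1` is expanded up to `N + 1`, its copy multiplied by `x * q` only up to `N`, because the
    -- latter is shifted by one.
    have h1 := ih (q * x) (N + 1) (by omega)
    have h2 := ih (q * x) N (by omega)
    rw [Finset.prod_range_succ']
    have h3 : ∏ k ∈ Finset.range n, (1 + x * q ^ (k + 1 + 1)) =
        ∏ k ∈ Finset.range n, (1 + q * x * q ^ (k + 1)) :=
      Finset.prod_congr rfl fun k _ => by ring
    rw [h3, mul_add, mul_one]
    nth_rewrite 1 [← h1]
    rw [← h2, Finset.sum_range_succ', Finset.sum_range_succ' _ (N + 1), Finset.sum_mul, add_right_comm,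
      ← Finset.sum_add_distrib]
    congr 1
    · refine Finset.sum_congr rfl fun m _ => ?_
      rw [gaussBinom_succ_succ, triangular_succ]
      ring
    · simp

theorem sum_gaussBinom_eq_qPochhammer (n N : ℕ) (h : n ≤ N) :
    ∑ m ∈ Finset.range (N + 1), q ^ triangular m * gaussBinom q n m = qPochhammer (-q) q n := by
  have := sum_gaussBinom_eq_prod q 1 n N h
  have h2 := qPochhammer_neg_self_add q 0 n
  simp [qPochhammer_zero] at this h2
  rw [this, h2]

/-- The `q`-Vandermonde convolution: the coefficient of `x^t` in `1/(x;q)_(M+N+2) = 1/(x;q)_(N+1) *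
1/(x q^(N+1);q)_(M+1)`. The proof is instead an induction on `M` and `t` by Pascal's rule. -/
theorem sum_antidiagonal_gaussBinom_mul (M N t : ℕ) :
    ∑ p ∈ Finset.HasAntidiagonal.antidiagonal t,
      q ^ (p.2 * (N + 1)) * gaussBinom q (M + p.2) p.2 * gaussBinom q (N + p.1) p.1 =
      gaussBinom q (M + N + 1 + t) t := by
  induction M generalizing t with
  | zero =>
    induction t with
    | zero => simp
    | succ t ih =>
      rw [Finset.Nat.sum_antidiagonal_succ', show 0 + N + 1 + (t + 1) = N + 1 + t + 1 by ring,
        gaussBinom_add_succ, show N + 1 + t = 0 + N + 1 + t by ring, ← ih, Finset.mul_sum]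
      congr 1
      · simp [add_assoc]
      · refine Finset.sum_congr rfl fun p _ => ?_
        simp only [zero_add, gaussBinom_self]
        ring
  | succ M ihM =>
    induction t with
    | zero => simp
    | succ t ih =>
      have h1 := ihM (t + 1)
      have assoc : ∀ a b c : R, a + b + c = a + (b + c) := add_assoc
      rw [Finset.Nat.sum_antidiagonal_succ'] at h1 ⊢
      rw [show M + 1 + N + 1 + (t + 1) = (M + N + 1) + 1 + t + 1 by ring, gaussBinom_add_succ,
        show M + N + 1 + 1 + t = M + 1 + N + 1 + t by ring, ← ih,
        show M + N + 1 + t + 1 = M + N + 1 + (t + 1) by ring, ← h1, assoc, Finset.mul_sum,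
        ← Finset.sum_add_distrib]
      congr 1
      · simp
      · refine Finset.sum_congr rfl fun p _ => ?_
        rw [show M + 1 + (p.2 + 1) = M + 1 + p.2 + 1 by ring, gaussBinom_add_succ]
        ring_nf

/-- In the induction on `i`, the dual Pascal rule pairs `(-q;q)_(B+p+1)` with `-q^(B+p+1)
(-q;q)_(B+p)`, where `p` is `p.2`. Their sum is `(-q;q)_(B+p)`, which restores the sum for `i`. -/
theorem sum_neg_one_pow_gaussBinom (B i : ℕ) :
    ∑ p ∈ Finset.HasAntidiagonal.antidiagonal i,
      (-1) ^ p.1 * q ^ (p.1 * (B + 1)) * gaussBinom q i p.1 * qPochhammer (-q) q (B + p.2) =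
      qPochhammer (-q) q B := by
  induction i with
  | zero => simp
  | succ i ih =>
    have h0 : ∑ p ∈ Finset.HasAntidiagonal.antidiagonal (i + 1), (-1) ^ p.1 * q ^ (p.1 * (B + 1)) *
        gaussBinom q i p.1 * qPochhammer (-q) q (B + p.2) =
        ∑ p ∈ Finset.HasAntidiagonal.antidiagonal i, (-1) ^ p.1 * q ^ (p.1 * (B + 1)) *
        gaussBinom q i p.1 * qPochhammer (-q) q (B + (p.2 + 1)) := by
      rw [Finset.Nat.sum_antidiagonal_succ', gaussBinom_eq_zero_of_lt q (Nat.lt_succ_self i)]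
      simp
    rw [Finset.Nat.sum_antidiagonal_succ] at h0 ⊢
    have h1 : ∀ p ∈ Finset.HasAntidiagonal.antidiagonal i,
        (-1) ^ (p.1 + 1) * q ^ ((p.1 + 1) * (B + 1)) * gaussBinom q (i + 1) (p.1 + 1) *
          qPochhammer (-q) q (B + p.2) =
        (-1) ^ (p.1 + 1) * q ^ ((p.1 + 1) * (B + 1)) * gaussBinom q i (p.1 + 1) *
          qPochhammer (-q) q (B + p.2) -
        (-1) ^ p.1 * q ^ (p.1 * (B + 1)) * gaussBinom q i p.1 *
          qPochhammer (-q) q (B + p.2) * q ^ (B + p.2 + 1) := by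
      intro p hp
      rw [Finset.HasAntidiagonal.mem_antidiagonal] at hp
      rw [gaussBinom_succ_succ' q i p.1 (by omega), show i - p.1 = p.2 by omega]
      ring
    rw [Finset.sum_congr rfl h1, Finset.sum_sub_distrib, ← add_sub_assoc]
    simp only [gaussBinom_zero_right] at h0 ⊢
    rw [h0, ← Finset.sum_sub_distrib, ← ih]
    refine Finset.sum_congr rfl fun p _ => ?_
    rw [← add_assoc, qPochhammer_neg_self_succ]
    ring

end Ring

/-! ### Trinomial revision and the sum over `k`. -/

section Field

variable {K : Type*} [Field K] {q : K}

theorem gaussBinom_add_eq_div (hq : ∀ n, qPochhammer q q n ≠ 0) (k e : ℕ) :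
    gaussBinom q (k + e) k =
      qPochhammer q q (k + e) / (qPochhammer q q k * qPochhammer q q e) := by
  rw [eq_div_iff (mul_ne_zero (hq _) (hq _)), gaussBinom_mul_qPochhammer]

theorem gaussBinom_add_eq_div' (hq : ∀ n, qPochhammer q q n ≠ 0) (k e : ℕ) :
    gaussBinom q (k + e) e =
      qPochhammer q q (k + e) / (qPochhammer q q k * qPochhammer q q e) := by
  rw [add_comm k e, gaussBinom_add_eq_div hq, mul_comm (qPochhammer q q k)]

/-- Both products are the `q`-trinomial `(q)_n / ((q)_k (q)_i (q)_(n-k-i))`, or zero when `k + i >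
n`. -/
theorem gaussBinom_mul_gaussBinom_sub_comm (hq : ∀ n, qPochhammer q q n ≠ 0) (n k i : ℕ) :
    gaussBinom q n k * gaussBinom q (n - k) i = gaussBinom q n i * gaussBinom q (n - i) k := by
  rcases Nat.lt_or_ge n (k + i) with h | h
  · have aux : ∀ a b : ℕ, n < a + b → gaussBinom q n a * gaussBinom q (n - a) b = 0 := by
      intro a b hab
      rcases Nat.lt_or_ge n a with ha | ha
      · rw [gaussBinom_eq_zero_of_lt q ha, zero_mul]
      · rw [gaussBinom_eq_zero_of_lt q (show n - a < b by omega), mul_zero]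
    rw [aux k i h, aux i k (by omega)]
  · obtain ⟨e, rfl⟩ := Nat.exists_eq_add_of_le h
    rw [show k + i + e - k = i + e by omega, show k + i + e - i = k + e by omega,
      gaussBinom_add_eq_div hq i, gaussBinom_add_eq_div hq k e,
      show k + i + e = k + (i + e) by ring, gaussBinom_add_eq_div hq k,
      show k + (i + e) = i + (k + e) by ring, gaussBinom_add_eq_div hq i]
    have := hq i; have := hq k; have := hq e; have := hq (i + e); have := hq (k + e)
    field_simp

theorem gaussBinom_mul_gaussBinom_sub (hq : ∀ n, qPochhammer q q n ≠ 0) (n s r : ℕ) :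
    gaussBinom q n s * gaussBinom q (n - s) r =
      gaussBinom q n (s + r) * gaussBinom q (s + r) s := by
  rcases Nat.lt_or_ge n (s + r) with h | h
  · rw [gaussBinom_eq_zero_of_lt q h, zero_mul]
    rcases Nat.lt_or_ge n s with ha | ha
    · rw [gaussBinom_eq_zero_of_lt q ha, zero_mul]
    · rw [gaussBinom_eq_zero_of_lt q (show n - s < r by omega), mul_zero]
  · obtain ⟨e, rfl⟩ := Nat.exists_eq_add_of_le h
    rw [show s + r + e - s = r + e by omega, gaussBinom_add_eq_div hq (s + r),
      gaussBinom_add_eq_div hq s r, show s + r + e = s + (r + e) by ring,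
      gaussBinom_add_eq_div hq s, gaussBinom_add_eq_div hq r]
    have := hq s; have := hq r; have := hq e; have := hq (s + r); have := hq (r + e)
    field_simp

/-- For `c = 0` trinomial revision takes `k` out of the second factor, and both sides reduce to `[A;
i] (-q;q)_(A-i)`. Raising `c` is Pascal's rule, which both sides obey. -/
theorem sum_gaussBinom_mul_gaussBinom_sub (hq : ∀ n, qPochhammer q q n ≠ 0) (A c i N : ℕ)
    (hN : A ≤ N) :
    ∑ k ∈ Finset.range (N + 1), q ^ triangular k * gaussBinom q A k * gaussBinom q (A + c - k) i =
      ∑ p ∈ Finset.HasAntidiagonal.antidiagonal i, (-1) ^ p.1 * q ^ (p.1 * (A + c - i + 1)) *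
        gaussBinom q A p.1 * gaussBinom q (A + c - p.1) p.2 * qPochhammer (-q) q (A - p.1) := by
  induction c generalizing i with
  | zero =>
    simp only [add_zero]
    have hl : ∀ k ∈ Finset.range (N + 1),
        q ^ triangular k * gaussBinom q A k * gaussBinom q (A - k) i =
        gaussBinom q A i * (q ^ triangular k * gaussBinom q (A - i) k) := by
      intro k _
      linear_combination q ^ triangular k * gaussBinom_mul_gaussBinom_sub_comm hq A k i
    rw [Finset.sum_congr rfl hl, ← Finset.mul_sum,
      sum_gaussBinom_eq_qPochhammer q _ _ (show A - i ≤ N by omega)]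
    rcases Nat.lt_or_ge A i with h | h
    · rw [gaussBinom_eq_zero_of_lt q h, zero_mul, Finset.sum_eq_zero]
      intro p hp
      rw [Finset.HasAntidiagonal.mem_antidiagonal] at hp
      have := gaussBinom_mul_gaussBinom_sub hq A p.1 p.2
      rw [gaussBinom_eq_zero_of_lt q (show A < p.1 + p.2 by omega)] at this
      linear_combination (-1) ^ p.1 * q ^ (p.1 * (A - i + 1)) * qPochhammer (-q) q (A - p.1) * this
    · obtain ⟨B, rfl⟩ := Nat.exists_eq_add_of_le h
      rw [show i + B - i = B by omega]
      rw [← sum_neg_one_pow_gaussBinom q B i, Finset.mul_sum]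
      refine Finset.sum_congr rfl fun p hp => ?_
      rw [Finset.HasAntidiagonal.mem_antidiagonal] at hp
      subst hp
      rw [show p.1 + p.2 + B - p.1 = B + p.2 by omega]
      have := gaussBinom_mul_gaussBinom_sub hq (p.1 + p.2 + B) p.1 p.2
      rw [show p.1 + p.2 + B - p.1 = B + p.2 by omega] at this
      linear_combination (-1) * (-1) ^ p.1 * q ^ (p.1 * (B + 1)) * qPochhammer (-q) q (B + p.2) * this
  | succ c ih =>
    cases i with
    | zero =>
      simp only [gaussBinom_zero_right, mul_one]
      rw [sum_gaussBinom_eq_qPochhammer q A N hN]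
      simp
    | succ i =>
      have hl : ∀ k ∈ Finset.range (N + 1),
          q ^ triangular k * gaussBinom q A k * gaussBinom q (A + (c + 1) - k) (i + 1) =
          q ^ (i + 1) * (q ^ triangular k * gaussBinom q A k * gaussBinom q (A + c - k) (i + 1)) +
          q ^ triangular k * gaussBinom q A k * gaussBinom q (A + c - k) i := by
        intro k _
        rcases Nat.lt_or_ge A k with h | h
        · simp [gaussBinom_eq_zero_of_lt q h]
        · rw [show A + (c + 1) - k = A + c - k + 1 by omega, gaussBinom_succ_succ]
          ring
      rw [Finset.sum_congr rfl hl, Finset.sum_add_distrib, ← Finset.mul_sum, ih, ih,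
        Finset.Nat.sum_antidiagonal_succ', Finset.Nat.sum_antidiagonal_succ', mul_add, add_assoc,
        Finset.mul_sum, ← Finset.sum_add_distrib]
      congr 1
      · rcases Nat.lt_or_ge A (i + 1) with h | h
        · simp [gaussBinom_eq_zero_of_lt q h]
        · obtain ⟨B, rfl⟩ := Nat.exists_eq_add_of_le h
          simp only [gaussBinom_zero_right]
          rw [show i + 1 + B + c - (i + 1) + 1 = B + c + 1 by omega,
            show i + 1 + B + (c + 1) - (i + 1) + 1 = B + c + 2 by omega]
          ring
      · refine Finset.sum_congr rfl fun p hp => ?_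
        rw [Finset.HasAntidiagonal.mem_antidiagonal] at hp
        rcases Nat.lt_or_ge A p.1 with h | h
        · simp [gaussBinom_eq_zero_of_lt q h]
        rw [show A + (c + 1) - p.1 = A + c - p.1 + 1 by omega, gaussBinom_succ_succ,
          show A + (c + 1) - (i + 1) + 1 = A + c - i + 1 by omega]
        rcases Nat.lt_or_ge i (A + c) with h2 | h2
        · obtain ⟨B, hB⟩ := Nat.exists_eq_add_of_lt h2
          rw [show A + c - (i + 1) + 1 = B + 1 by omega, show A + c - i + 1 = B + 2 by omega, ← hp]
          ring
        -- Here the exponents involving `A + c - i` are truncated, but the only binomial whose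
        -- exponent would then be wrong vanishes.
        · rw [gaussBinom_eq_zero_of_lt q (show A + c - p.1 < p.2 + 1 by omega)]
          ring

end Field

/-! ### Folding the cyclic triple sum into a single sum. -/

/-- The summand of the single sum to which the coefficients of the cyclic triple sum reduce. -/
def foldedTerm {R : Type*} [CommRing R] (q : R) (d n t : ℕ) : R :=
  (-1) ^ t * q ^ (triangular n + triangular t) * qPochhammer (-q) q (n + d) *
    gaussBinom q (n + d) n * gaussBinom q (2 * n + 2 * d + 1 + t) t

theorem sum_antidiagonal_antidiagonal_comm {M : Type*} [AddCommMonoid M] (m : ℕ)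
    (g : ℕ → ℕ → ℕ → M) :
    ∑ p ∈ Finset.HasAntidiagonal.antidiagonal m,
      ∑ r ∈ Finset.HasAntidiagonal.antidiagonal p.1, g r.2 p.2 r.1 =
    ∑ p ∈ Finset.HasAntidiagonal.antidiagonal m,
      ∑ r ∈ Finset.HasAntidiagonal.antidiagonal p.2, g p.1 r.1 r.2 := by
  simp only [Finset.sum_sigma']
  refine Finset.sum_nbij' (fun x => ⟨(x.2.2, x.1.2 + x.2.1), (x.1.2, x.2.1)⟩)
    (fun x => ⟨(x.1.1 + x.2.2, x.2.1), (x.2.2, x.1.1)⟩) ?_ ?_ ?_ ?_ ?_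
  · rintro ⟨⟨a, b⟩, ⟨c, e⟩⟩ h
    simp only [Finset.mem_sigma, Finset.HasAntidiagonal.mem_antidiagonal, and_true] at h ⊢
    omega
  · rintro ⟨⟨a, b⟩, ⟨c, e⟩⟩ h
    simp only [Finset.mem_sigma, Finset.HasAntidiagonal.mem_antidiagonal] at h ⊢
    omega
  · rintro ⟨⟨a, b⟩, ⟨c, e⟩⟩ h
    simp only [Finset.mem_sigma, Finset.HasAntidiagonal.mem_antidiagonal] at h
    obtain ⟨rfl, rfl⟩ := h
    simp [add_comm]
  · rintro ⟨⟨a, b⟩, ⟨c, e⟩⟩ h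
    simp only [Finset.mem_sigma, Finset.HasAntidiagonal.mem_antidiagonal] at h
    obtain ⟨rfl, rfl⟩ := h
    simp
  · rintro ⟨⟨a, b⟩, ⟨c, e⟩⟩ _
    rfl

section Field

variable {K : Type*} [Field K] {q : K}

/-- The sum over `k` is replaced with `A = i + d` and `c = j`, giving triples with `i = n + s`. For
fixed `n` and `t = j + s`, trinomial revision (`h4`) and the exponent identity `h5` isolate a
Vandermonde sum with `M = N = n + d`. -/
theorem sum_cyclic_eq_sum_foldedTerm (hq : ∀ n, qPochhammer q q n ≠ 0) (m d : ℕ) :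
    ∑ p ∈ Finset.HasAntidiagonal.antidiagonal m, ∑ k ∈ Finset.range (m + d + 1),
      (-1) ^ p.2 * q ^ (triangular p.1 + triangular p.2 + triangular k) *
        gaussBinom q (m + d - p.1) p.2 * gaussBinom q (m + d - p.2) k *
        gaussBinom q (m + d - k) p.1 =
    ∑ p ∈ Finset.HasAntidiagonal.antidiagonal m, foldedTerm q d p.1 p.2 := by
  have h1 : ∀ p ∈ Finset.HasAntidiagonal.antidiagonal m, ∑ k ∈ Finset.range (m + d + 1),
      (-1) ^ p.2 * q ^ (triangular p.1 + triangular p.2 + triangular k) *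
        gaussBinom q (m + d - p.1) p.2 * gaussBinom q (m + d - p.2) k *
        gaussBinom q (m + d - k) p.1 =
      ∑ r ∈ Finset.HasAntidiagonal.antidiagonal p.1,
        (-1) ^ (p.2 + r.1) * q ^ (triangular (r.2 + r.1) + triangular p.2) *
        q ^ (r.1 * (d + p.2 + 1)) * gaussBinom q (d + p.2) p.2 *
        gaussBinom q (r.2 + d + r.1) r.1 * gaussBinom q (r.2 + d + p.2) r.2 *
        qPochhammer (-q) q (r.2 + d) := by
    rintro ⟨i, j⟩ hp
    rw [Finset.HasAntidiagonal.mem_antidiagonal] at hp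
    obtain rfl : i + j = m := hp
    have := sum_gaussBinom_mul_gaussBinom_sub hq (i + d) j i (i + j + d) (by omega)
    simp only [show i + j + d - i = d + j by omega, show i + j + d - j = i + d by omega]
    rw [show i + d + j = i + j + d by ring] at this
    have h2 : ∀ k ∈ Finset.range (i + j + d + 1),
        (-1) ^ j * q ^ (triangular i + triangular j + triangular k) *
        gaussBinom q (d + j) j * gaussBinom q (i + d) k * gaussBinom q (i + j + d - k) i =
        (-1) ^ j * q ^ (triangular i + triangular j) * gaussBinom q (d + j) j *
        (q ^ triangular k * gaussBinom q (i + d) k * gaussBinom q (i + j + d - k) i) := by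
      intro k _
      ring
    rw [Finset.sum_congr rfl h2, ← Finset.mul_sum, this, Finset.mul_sum]
    refine Finset.sum_congr rfl fun r hr => ?_
    rw [Finset.HasAntidiagonal.mem_antidiagonal] at hr
    obtain ⟨s, n⟩ := r
    obtain rfl : i = n + s := by rw [← hr]; exact add_comm s n
    dsimp only
    rw [show n + s + j + d - (n + s) + 1 = d + j + 1 by omega,
      show n + s + j + d - s = n + d + j by omega, show n + s + d - s = n + d by omega,
      show n + s + d = n + d + s by omega]
    ring
  rw [Finset.sum_congr rfl h1, sum_antidiagonal_antidiagonal_comm m (fun n j s =>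
    (-1) ^ (j + s) * q ^ (triangular (n + s) + triangular j) *
        q ^ (s * (d + j + 1)) * gaussBinom q (d + j) j *
        gaussBinom q (n + d + s) s * gaussBinom q (n + d + j) n *
        qPochhammer (-q) q (n + d))]
  refine Finset.sum_congr rfl fun p _ => ?_
  obtain ⟨n, t⟩ := p
  have h3 : 2 * n + 2 * d + 1 + t = (n + d) + (n + d) + 1 + t := by ring
  simp only [foldedTerm]
  rw [h3, ← sum_antidiagonal_gaussBinom_mul, Finset.mul_sum]
  refine Finset.sum_congr rfl fun r hr => ?_
  rw [Finset.HasAntidiagonal.mem_antidiagonal] at hr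
  obtain ⟨j, s⟩ := r
  obtain rfl : j + s = t := hr
  have h4 : gaussBinom q (d + j) j * gaussBinom q (n + d + j) n =
      gaussBinom q (n + d) n * gaussBinom q (n + d + j) j := by
    have := gaussBinom_mul_gaussBinom_sub_comm hq (n + d + j) n j
    rw [show n + d + j - n = d + j by omega, show n + d + j - j = n + d by omega] at this
    linear_combination this
  have h5 : triangular (n + s) + triangular j + s * (d + j + 1) =
      triangular n + triangular (j + s) + s * (n + d + 1) := by
    rw [triangular_add, triangular_add]; ring
  have h6 : q ^ (triangular (n + s) + triangular j) * q ^ (s * (d + j + 1)) =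
      q ^ (triangular n + triangular (j + s)) * q ^ (s * (n + d + 1)) := by
    rw [← pow_add, h5, pow_add]
  dsimp only
  linear_combination (-1) ^ (j + s) * gaussBinom q (d + j) j *
        gaussBinom q (n + d + s) s * gaussBinom q (n + d + j) n *
        qPochhammer (-q) q (n + d) * h6 + (-1) ^ (j + s) *
      (q ^ (triangular n + triangular (j + s)) * q ^ (s * (n + d + 1))) *
      gaussBinom q (n + d + s) s * qPochhammer (-q) q (n + d) * h4

theorem foldedTerm_eq_div (hq : ∀ n, qPochhammer q q n ≠ 0) (d n t : ℕ) :
    foldedTerm q d n t = (-1) ^ t * q ^ triangular n * q ^ triangular t *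
      qPochhammer (-q) q (n + d) * qPochhammer q q (n + d) *
      qPochhammer q q (2 * n + 2 * d + t + 1) / (qPochhammer q q n * qPochhammer q q d *
        qPochhammer q q (2 * n + 2 * d + 1) * qPochhammer q q t) := by
  rw [foldedTerm, gaussBinom_add_eq_div hq, gaussBinom_add_eq_div' hq,
    show 2 * n + 2 * d + 1 + t = 2 * n + 2 * d + t + 1 by ring, pow_add]
  have := hq n; have := hq d; have := hq t; have := hq (2 * n + 2 * d + 1)
  field_simp

/-! ### The recurrence by creative telescoping, and its solution. -/

/-- The telescoping certificate for the recurrence of the folded sums. -/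
def foldedCert (q : K) (d k e : ℕ) : K :=
  -(1 - q ^ (2 * (k + e + 2) + 2 * d)) * (1 - q ^ k) * (1 - q ^ (2 * k + 2 * d + 1)) *
    ((-1) ^ e * q ^ triangular k * q ^ triangular (e + 2) *
      qPochhammer (-q) q (k + d) * qPochhammer q q (k + d) *
      qPochhammer q q (2 * k + 2 * d + e + 1) / (qPochhammer q q k * qPochhammer q q d *
        qPochhammer q q (2 * k + 2 * d + 1) * qPochhammer q q (e + 2)))

theorem one_sub_pow_succ_ne_zero (hq : ∀ n, qPochhammer q q n ≠ 0) (n : ℕ) :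
    1 - q ^ (n + 1) ≠ 0 := by
  have := hq (n + 1)
  rw [qPochhammer_self_succ] at this
  exact right_ne_zero_of_mul this

/-- With `m = k + e + 1`, the bracket is the term `n = k` of the recurrence combination, so
`foldedCert` accumulates its partial sums. The factor `1 - q ^ k` in `foldedCert` makes the empty
sum zero. -/
theorem foldedCert_step (hq : ∀ n, qPochhammer q q n ≠ 0) (d k e : ℕ) :
    foldedCert q d k (e + 1) + ((1 - q ^ (k + e + 3)) * foldedTerm q d k (e + 3) +
      q ^ (k + e + 3) * (1 - q ^ (k + e + 3 + 2 * d)) * foldedTerm q d k (e + 1)) =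
    foldedCert q d (k + 1) e := by
  rw [foldedTerm_eq_div hq, foldedTerm_eq_div hq, foldedCert, foldedCert]
  have e1 : 2 * k + 2 * d + (e + 3) + 1 = 2 * k + 2 * d + e + 2 + 1 + 1 := by ring
  have e2 : 2 * k + 2 * d + (e + 1) + 1 = 2 * k + 2 * d + e + 2 := by ring
  have e3 : 2 * (k + 1) + 2 * d + e + 1 = 2 * k + 2 * d + e + 2 + 1 := by ring
  have e4 : 2 * (k + 1) + 2 * d + 1 = 2 * k + 2 * d + 1 + 1 + 1 := by ring
  have e5 : k + 1 + d = k + d + 1 := by ring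
  rw [e1, e2, e3, e4, e5]
  simp only [show e + 1 + 2 = e + 1 + 1 + 1 by ring,
    show e + 2 = e + 1 + 1 by ring, qPochhammer_self_succ q (2 * k + 2 * d + e + 2 + 1),
    qPochhammer_self_succ q (2 * k + 2 * d + e + 2),
    qPochhammer_self_succ q (2 * k + 2 * d + 1 + 1), qPochhammer_self_succ q (2 * k + 2 * d + 1),
    qPochhammer_self_succ q (k + d), qPochhammer_neg_self_succ, qPochhammer_self_succ q k,
    qPochhammer_self_succ q (e + 1 + 1), qPochhammer_self_succ q (e + 1), triangular_succ]
  have h1 := hq k; have h2 := hq d; have h3 := hq (e + 1); have h4 := hq (2 * k + 2 * d + 1)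
  have n1 := one_sub_pow_succ_ne_zero hq k
  have n2 := one_sub_pow_succ_ne_zero hq (e + 1)
  have n3 := one_sub_pow_succ_ne_zero hq (e + 1 + 1)
  have n4 := one_sub_pow_succ_ne_zero hq (2 * k + 2 * d + 1)
  have n5 := one_sub_pow_succ_ne_zero hq (2 * k + 2 * d + 1 + 1)
  generalize qPochhammer q q k = Pk at *
  generalize qPochhammer q q d = Pd at *
  generalize qPochhammer q q (e + 1) = Pe at *
  generalize qPochhammer q q (2 * k + 2 * d + 1) = P2 at *
  generalize qPochhammer q q (2 * k + 2 * d + e + 2) = X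
  generalize qPochhammer q q (k + d) = Y
  generalize qPochhammer (-q) q (k + d) = Z
  generalize triangular e = Te
  generalize triangular k = Tk
  -- All Pochhammer symbols now enter as common factors; what remains is a rational identity in `q`,
  -- `q ^ k`, `q ^ d` and `q ^ e`.
  simp only [pow_add, two_mul, pow_one, pow_two] at n1 n2 n3 n4 n5 ⊢
  generalize q ^ k = x at *
  generalize q ^ d = D at *
  generalize q ^ e = y at *
  generalize q ^ Te = a
  generalize q ^ Tk = b
  replace n2 : 1 - y * q ^ 2 ≠ 0 := fun h => n2 (by linear_combination h)
  replace n3 : 1 - y * q ^ 3 ≠ 0 := fun h => n3 (by linear_combination h)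
  replace n4 : 1 - x ^ 2 * q ^ 2 * D ^ 2 ≠ 0 := fun h => n4 (by linear_combination h)
  replace n5 : 1 - x ^ 2 * q ^ 3 * D ^ 2 ≠ 0 := fun h => n5 (by linear_combination h)
  field_simp
  ring

/-- Telescoping covers `n < m`. Left over are `n = m`, present in both sums, and `n = m + 1`, `m +
2`, present only in the longer one; they cancel the last certificate value. -/
theorem foldedTerm_recurrence_boundary (hq : ∀ n, qPochhammer q q n ≠ 0) (d m : ℕ) :
    foldedCert q d m 0 + ((1 - q ^ (m + 2)) * foldedTerm q d m 2 +
      q ^ (m + 2) * (1 - q ^ (m + 2 + 2 * d)) * foldedTerm q d m 0) +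
      (1 - q ^ (m + 2)) * foldedTerm q d (m + 1) 1 +
      (1 - q ^ (m + 2)) * foldedTerm q d (m + 2) 0 = 0 := by
  rw [foldedTerm_eq_div hq, foldedTerm_eq_div hq, foldedTerm_eq_div hq, foldedTerm_eq_div hq,
    foldedCert]
  have e1 : 2 * m + 2 * d + 2 + 1 = 2 * m + 2 * d + 1 + 1 + 1 := by ring
  have e2 : 2 * m + 2 * d + 0 + 1 = 2 * m + 2 * d + 1 := by ring
  have e3 : 2 * (m + 1) + 2 * d + 1 + 1 = 2 * m + 2 * d + 1 + 1 + 1 + 1 := by ring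
  have e4 : 2 * (m + 1) + 2 * d + 1 = 2 * m + 2 * d + 1 + 1 + 1 := by ring
  have e5 : m + 1 + d = m + d + 1 := by ring
  have e6 : m + 2 + d = m + d + 1 + 1 := by ring
  have e7 : 2 * (m + 2) + 2 * d + 0 + 1 = 2 * (m + 2) + 2 * d + 1 := by ring
  rw [e3, e1, e2, e4, e5, e6, e7]
  have t0 : triangular 0 = 0 := rfl
  have t1 : triangular 1 = 1 := rfl
  have t2 : triangular 2 = 3 := rfl
  have p2 : qPochhammer q q 2 = (1 - q) * (1 - q ^ 2) := by
    simp only [qPochhammer, Finset.prod_range_succ, Finset.prod_range_zero]; ring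
  have p1 : qPochhammer q q 1 = 1 - q := by simp [qPochhammer]
  simp only [t0, t1, t2, show m + 2 = m + 1 + 1 by ring, zero_add,
    qPochhammer_self_succ q (2 * m + 2 * d + 1 + 1 + 1),
    qPochhammer_self_succ q (2 * m + 2 * d + 1 + 1), qPochhammer_self_succ q (2 * m + 2 * d + 1),
    qPochhammer_self_succ q (m + d), qPochhammer_self_succ q (m + d + 1),
    qPochhammer_neg_self_succ, qPochhammer_self_succ q m, qPochhammer_self_succ q (m + 1),
    p2, p1, qPochhammer_zero, triangular_succ]
  have h1 := hq m; have h2 := hq d; have h4 := hq (2 * m + 2 * d + 1)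
  have h5 := hq (2 * (m + 1 + 1) + 2 * d + 1)
  have n1 := one_sub_pow_succ_ne_zero hq m
  have n2 := one_sub_pow_succ_ne_zero hq (m + 1)
  have n3 := one_sub_pow_succ_ne_zero hq 0
  have n4 := one_sub_pow_succ_ne_zero hq (2 * m + 2 * d + 1)
  have n5 := one_sub_pow_succ_ne_zero hq (2 * m + 2 * d + 1 + 1)
  have n6 := one_sub_pow_succ_ne_zero hq 1
  generalize qPochhammer q q m = Pm at *
  generalize qPochhammer q q d = Pd at *
  generalize qPochhammer q q (2 * m + 2 * d + 1) = P2 at *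
  generalize qPochhammer q q (2 * (m + 1 + 1) + 2 * d + 1) = P3 at *
  generalize qPochhammer q q (m + d) = Y
  generalize qPochhammer (-q) q (m + d) = Z
  generalize triangular m = Tm
  simp only [pow_add, two_mul, pow_one, pow_two, pow_zero, one_mul] at n1 n2 n3 n4 n5 n6 ⊢
  generalize q ^ m = x at *
  generalize q ^ d = D at *
  generalize q ^ Tm = b
  replace n2 : 1 - x * q ^ 2 ≠ 0 := fun h => n2 (by linear_combination h)
  replace n6 : 1 - q ^ 2 ≠ 0 := fun h => n6 (by linear_combination h)
  replace n4 : 1 - x ^ 2 * q ^ 2 * D ^ 2 ≠ 0 := fun h => n4 (by linear_combination h)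
  replace n5 : 1 - x ^ 2 * q ^ 3 * D ^ 2 ≠ 0 := fun h => n5 (by linear_combination h)
  field_simp
  ring

theorem sum_foldedTerm_add_two (hq : ∀ n, qPochhammer q q n ≠ 0) (d m : ℕ) :
    (1 - q ^ (m + 2)) * ∑ p ∈ Finset.HasAntidiagonal.antidiagonal (m + 2), foldedTerm q d p.1 p.2 +
      q ^ (m + 2) * (1 - q ^ (m + 2 + 2 * d)) *
        ∑ p ∈ Finset.HasAntidiagonal.antidiagonal m, foldedTerm q d p.1 p.2 = 0 := by
  have partial_sum : ∀ k e, k + e = m → ∑ n ∈ Finset.range k,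
      ((1 - q ^ (m + 2)) * foldedTerm q d n (m + 2 - n) +
        q ^ (m + 2) * (1 - q ^ (m + 2 + 2 * d)) * foldedTerm q d n (m - n)) =
      foldedCert q d k e := by
    intro k
    induction k with
    | zero => intro e _; simp [foldedCert]
    | succ k ih =>
      intro e he
      rw [Finset.sum_range_succ, ih (e + 1) (by omega), ← foldedCert_step hq,
        show m + 2 - k = e + 3 by omega, show m - k = e + 1 by omega,
        show m + 2 = k + e + 3 by omega]
  have h := partial_sum m 0 rfl
  have hb := foldedTerm_recurrence_boundary hq d m
  rw [Finset.sum_add_distrib, ← Finset.mul_sum, ← Finset.mul_sum] at h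
  rw [Finset.Nat.sum_antidiagonal_eq_sum_range_succ (foldedTerm q d),
    Finset.Nat.sum_antidiagonal_eq_sum_range_succ (foldedTerm q d), Finset.sum_range_succ,
    Finset.sum_range_succ, Finset.sum_range_succ, Finset.sum_range_succ _ m,
    show m + 2 - m = 2 by omega, show m + 2 - (m + 1) = 1 by omega, Nat.sub_self, Nat.sub_self]
  linear_combination h + hb

theorem sum_foldedTerm_odd (hq : ∀ n, qPochhammer q q n ≠ 0) (d r : ℕ) :
    ∑ p ∈ Finset.HasAntidiagonal.antidiagonal (2 * r + 1), foldedTerm q d p.1 p.2 = 0 := by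
  induction r with
  | zero =>
    have n1 := one_sub_pow_succ_ne_zero hq 0
    have h1 := gaussBinom_mul_qPochhammer q 1 d
    have h2 := gaussBinom_mul_qPochhammer q 1 (2 * d + 1)
    have p1 : qPochhammer q q 1 = 1 - q := by simp [qPochhammer]
    rw [add_comm 1 d, qPochhammer_self_succ q d, p1] at h1
    rw [add_comm 1, qPochhammer_self_succ q (2 * d + 1), p1] at h2
    have k1 : gaussBinom q (d + 1) 1 * (1 - q) = 1 - q ^ (d + 1) :=
      mul_right_cancel₀ (hq d) (by linear_combination h1)
    have k2 : gaussBinom q (2 * d + 1 + 1) 1 * (1 - q) = 1 - q ^ (2 * d + 1 + 1) :=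
      mul_right_cancel₀ (hq (2 * d + 1)) (by linear_combination h2)
    rw [zero_add, pow_one] at n1
    have e : ∑ p ∈ Finset.HasAntidiagonal.antidiagonal 1, foldedTerm q d p.1 p.2 =
        q * qPochhammer (-q) q d * (1 + q ^ (d + 1)) * gaussBinom q (d + 1) 1 -
          q * qPochhammer (-q) q d * gaussBinom q (2 * d + 1 + 1) 1 := by
      rw [Finset.Nat.sum_antidiagonal_succ]
      simp [foldedTerm, triangular, add_comm 1 d, qPochhammer_neg_self_succ]
      ring
    refine mul_right_cancel₀ n1 ?_
    rw [mul_zero, zero_add, e]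
    -- The two terms cancel because `(1 + q^(d+1)) (1 - q^(d+1)) = 1 - q^(2d+2)`.
    linear_combination q * qPochhammer (-q) q d * (1 + q ^ (d + 1)) * k1 -
      q * qPochhammer (-q) q d * k2
  | succ r ih =>
    have h := sum_foldedTerm_add_two hq d (2 * r + 1)
    rw [ih, mul_zero, add_zero] at h
    exact (mul_eq_zero.mp h).resolve_left (one_sub_pow_succ_ne_zero hq _)

/-- After multiplication by `(-q;q)_r` the product becomes `(-q;q)_(r+d)`, and the recurrence
matches through `1 - q^(2r+2+2d) = (1 - q^(r+d+1)) (1 + q^(r+d+1))`. -/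
theorem sum_foldedTerm_even (hq : ∀ n, qPochhammer q q n ≠ 0) (d r : ℕ) :
    ∑ p ∈ Finset.HasAntidiagonal.antidiagonal (2 * r), foldedTerm q d p.1 p.2 =
      (-1) ^ r * q ^ (triangular r + triangular r) * gaussBinom q (r + d) r *
        ∏ j ∈ Finset.range d, (1 + q ^ r * q ^ (j + 1)) := by
  have hM : ∀ n, qPochhammer (-q) q n ≠ 0 := by
    intro n
    induction n with
    | zero => simp [qPochhammer_zero]
    | succ n ih =>
      rw [qPochhammer_neg_self_succ]
      -- A zero of `1 + q^(n+1)` would be a zero of `1 - q^(2n+2)`.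
      refine mul_ne_zero ih fun h => one_sub_pow_succ_ne_zero hq (2 * n + 1) ?_
      linear_combination (1 - q ^ (n + 1)) * h
  refine mul_left_cancel₀ (hM r) ?_
  have hd := qPochhammer_neg_self_add q r d
  suffices qPochhammer (-q) q r *
      ∑ p ∈ Finset.HasAntidiagonal.antidiagonal (2 * r), foldedTerm q d p.1 p.2 =
      (-1) ^ r * q ^ (triangular r + triangular r) * gaussBinom q (r + d) r *
        qPochhammer (-q) q (r + d) by
    rw [this, hd]; ring
  clear hd
  rw [gaussBinom_add_eq_div hq]
  induction r with
  | zero => have := hq d; simp [foldedTerm, triangular, qPochhammer_zero, this]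
  | succ r ih =>
    have h := sum_foldedTerm_add_two hq d (2 * r)
    rw [show 2 * (r + 1) = 2 * r + 2 by ring]
    have n1 := one_sub_pow_succ_ne_zero hq (2 * r + 1)
    have n2 := one_sub_pow_succ_ne_zero hq r
    have h1 := hq r; have h2 := hq d
    refine mul_left_cancel₀ n1 ?_
    rw [show r + 1 + d = r + d + 1 by ring, qPochhammer_neg_self_succ, qPochhammer_neg_self_succ,
      qPochhammer_self_succ q (r + d), qPochhammer_self_succ q r, triangular_succ]
    have e : (-1) ^ (r + 1) * q ^ (triangular r + (r + 1) + (triangular r + (r + 1))) *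
        (qPochhammer q q (r + d) * (1 - q ^ (r + d + 1)) /
          (qPochhammer q q r * (1 - q ^ (r + 1)) * qPochhammer q q d)) *
        (qPochhammer (-q) q (r + d) * (1 + q ^ (r + d + 1))) * (1 - q ^ (r + 1)) =
        - q ^ (2 * r + 2) * (1 - q ^ (2 * r + 2 + 2 * d)) * ((-1) ^ r *
        q ^ (triangular r + triangular r) * (qPochhammer q q (r + d) /
          (qPochhammer q q r * qPochhammer q q d)) * qPochhammer (-q) q (r + d)) := by
      field_simp
      ring
    rw [← ih] at e
    refine mul_right_cancel₀ n2 ?_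
    linear_combination (1 - q ^ (2 * r + 2)) * (qPochhammer (-q) q r * h - e)

end Field

/-! ### Evaluation of the left-hand coefficients. -/

section Field

variable {K : Type*} [Field K] {q : K}

/-- Put `i = j + m`: trinomial revision gives `[j+d; j] [d; m]`, and `T_(j+m)` contributes
`(q^j)^m`, so the `q`-binomial theorem applies at `x = q ^ j`. -/
theorem sum_gaussBinom_mul_gaussBinom (hq : ∀ n, qPochhammer q q n ≠ 0) (j d : ℕ) :
    ∑ i ∈ Finset.range (2 * j + d + 1), q ^ (triangular i + triangular j) *
        gaussBinom q (j + d) i * gaussBinom q i j =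
      q ^ (triangular j + triangular j) * gaussBinom q (j + d) j *
        ∏ i ∈ Finset.range d, (1 + q ^ j * q ^ (i + 1)) := by
  rw [show 2 * j + d + 1 = j + (j + d + 1) by ring, Finset.sum_range_add, Finset.sum_eq_zero,
    zero_add, ← sum_gaussBinom_eq_prod q (q ^ j) d (j + d) (by omega), Finset.mul_sum]
  · refine Finset.sum_congr rfl fun m _ => ?_
    have := gaussBinom_mul_gaussBinom_sub hq (j + d) j m
    rw [show j + d - j = d by omega] at this
    rw [triangular_add, pow_add, pow_add, pow_add, pow_add, pow_mul]
    linear_combination (-1) * q ^ triangular j * q ^ triangular j * q ^ triangular m *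
      (q ^ j) ^ m * this
  · intro i hi
    rw [gaussBinom_eq_zero_of_lt q (Finset.mem_range.mp hi), mul_zero]

end Field

/-! ### Transfer from the fraction field to an arbitrary `ℚ`-algebra. -/

theorem qPochhammer_X_ne_zero (n : ℕ) : qPochhammer (X : ℚ[X]) X n ≠ 0 := by
  refine Finset.prod_ne_zero_iff.mpr fun j _ h => ?_
  have := congrArg (Polynomial.eval 0) h
  simp at this

theorem qPochhammer_algebraMap_X_ne_zero (n : ℕ) :
    qPochhammer (algebraMap ℚ[X] (FractionRing ℚ[X]) X) (algebraMap ℚ[X] (FractionRing ℚ[X]) X) n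
      ≠ 0 := by
  have h : algebraMap ℚ[X] (FractionRing ℚ[X]) (qPochhammer X X n) =
      qPochhammer (algebraMap ℚ[X] (FractionRing ℚ[X]) X)
        (algebraMap ℚ[X] (FractionRing ℚ[X]) X) n := by
    simp only [qPochhammer, map_prod, map_sub, map_one, map_mul, map_pow]
  rw [← h]
  exact (map_ne_zero_iff _ (IsFractionRing.injective _ _)).mpr (qPochhammer_X_ne_zero n)

section Algebra

variable {R : Type*} [CommRing R] [Algebra ℚ R] (q : R)

/-- Proving the identity for the indeterminate first makes it available also where some `(q)_n`
vanishes, as at roots of unity. -/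
theorem sum_cyclic_odd (r d : ℕ) :
    ∑ p ∈ Finset.HasAntidiagonal.antidiagonal (2 * r + 1),
      ∑ k ∈ Finset.range (2 * r + 1 + d + 1),
      (-1) ^ p.2 * q ^ (triangular p.1 + triangular p.2 + triangular k) *
        gaussBinom q (2 * r + 1 + d - p.1) p.2 * gaussBinom q (2 * r + 1 + d - p.2) k *
        gaussBinom q (2 * r + 1 + d - k) p.1 = 0 := by
  have h : ∑ p ∈ Finset.HasAntidiagonal.antidiagonal (2 * r + 1),
      ∑ k ∈ Finset.range (2 * r + 1 + d + 1),
      (-1) ^ p.2 * (X : ℚ[X]) ^ (triangular p.1 + triangular p.2 + triangular k) *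
        gaussBinom X (2 * r + 1 + d - p.1) p.2 * gaussBinom X (2 * r + 1 + d - p.2) k *
        gaussBinom X (2 * r + 1 + d - k) p.1 = 0 := by
    apply IsFractionRing.injective ℚ[X] (FractionRing ℚ[X])
    simp only [map_sum, map_mul, map_pow, map_neg, map_one, map_zero, map_gaussBinom]
    rw [sum_cyclic_eq_sum_foldedTerm qPochhammer_algebraMap_X_ne_zero,
      sum_foldedTerm_odd qPochhammer_algebraMap_X_ne_zero]
  simpa only [map_sum, map_mul, map_pow, map_neg, map_one, map_zero, map_gaussBinom,
    coe_eval₂RingHom, eval₂_X] using congrArg (eval₂RingHom (algebraMap ℚ R) q) h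

theorem sum_cyclic_even (r d : ℕ) :
    ∑ p ∈ Finset.HasAntidiagonal.antidiagonal (2 * r), ∑ k ∈ Finset.range (2 * r + d + 1),
      (-1) ^ p.2 * q ^ (triangular p.1 + triangular p.2 + triangular k) *
        gaussBinom q (2 * r + d - p.1) p.2 * gaussBinom q (2 * r + d - p.2) k *
        gaussBinom q (2 * r + d - k) p.1 =
    (-1) ^ r * ∑ i ∈ Finset.range (2 * r + d + 1), q ^ (triangular i + triangular r) *
        gaussBinom q (r + d) i * gaussBinom q i r := by
  have h : ∑ p ∈ Finset.HasAntidiagonal.antidiagonal (2 * r), ∑ k ∈ Finset.range (2 * r + d + 1),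
      (-1) ^ p.2 * (X : ℚ[X]) ^ (triangular p.1 + triangular p.2 + triangular k) *
        gaussBinom X (2 * r + d - p.1) p.2 * gaussBinom X (2 * r + d - p.2) k *
        gaussBinom X (2 * r + d - k) p.1 =
      (-1) ^ r * ∑ i ∈ Finset.range (2 * r + d + 1), X ^ (triangular i + triangular r) *
        gaussBinom X (r + d) i * gaussBinom X i r := by
    apply IsFractionRing.injective ℚ[X] (FractionRing ℚ[X])
    simp only [map_sum, map_mul, map_pow, map_neg, map_one, map_gaussBinom]
    rw [sum_cyclic_eq_sum_foldedTerm qPochhammer_algebraMap_X_ne_zero,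
      sum_foldedTerm_even qPochhammer_algebraMap_X_ne_zero,
      sum_gaussBinom_mul_gaussBinom qPochhammer_algebraMap_X_ne_zero]
    ring
  simpa only [map_sum, map_mul, map_pow, map_neg, map_one, map_gaussBinom,
    coe_eval₂RingHom, eval₂_X] using congrArg (eval₂RingHom (algebraMap ℚ R) q) h

theorem qBinomial_natCast (N n : ℕ) : qBinomial q N n = gaussBinom q N n := by
  rcases Nat.lt_or_ge N n with h | h
  · rw [gaussBinom_eq_zero_of_lt q h, qBinomial, qBinomialPoly, if_neg (by omega), map_zero]
  · obtain ⟨m, rfl⟩ := Nat.exists_eq_add_of_le h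
    have h1 : qBinomialPoly ((n + m : ℕ) : ℤ) n = gaussBinom X (n + m) n := by
      refine mul_right_cancel₀
        (mul_ne_zero (qPochhammer_X_ne_zero n) (qPochhammer_X_ne_zero m)) ?_
      rw [gaussBinom_mul_qPochhammer, Nat.cast_add, qBinomialPoly_mul]
    rw [qBinomial, h1]
    simpa using map_gaussBinom (X : ℚ[X]) (aeval q : ℚ[X] →ₐ[ℚ] R).toRingHom (n + m) n

/-- The guard matters: for `j > L` truncation would turn `[L-j; 0]` into `[0; 0] = 1`. -/
theorem qBinomial_natCast_sub (L j n : ℕ) :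
    qBinomial q ((L : ℤ) - j) n = if j ≤ L then gaussBinom q (L - j) n else 0 := by
  split_ifs with h
  · rw [← Nat.cast_sub h, qBinomial_natCast]
  · rw [qBinomial, qBinomialPoly, if_neg (by omega), map_zero]

end Algebra

/-! ### Finite ranges and comparison of powers of `z`. -/

theorem sum_range_sum_range_eq_sum_antidiagonal {M : Type*} [AddCommMonoid M] (L : ℕ)
    (f : ℕ → ℕ → M) (hf : ∀ i j, L < i + j → f i j = 0) :
    ∑ i ∈ Finset.range (L + 1), ∑ j ∈ Finset.range (L + 1), f i j =
      ∑ m ∈ Finset.range (L + 1), ∑ p ∈ Finset.HasAntidiagonal.antidiagonal m, f p.1 p.2 := by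
  simp only [Finset.Nat.sum_antidiagonal_eq_sum_range_succ f]
  rw [Finset.sum_range_diag_flip]
  refine Finset.sum_congr rfl fun i _ => (Finset.sum_subset ?_ ?_).symm
  · exact Finset.range_subset_range.mpr (Nat.sub_le _ _)
  · intro j _ hj
    rw [Finset.mem_range] at hj
    exact hf i j (by omega)

theorem sum_range_eq_sum_even {M : Type*} [AddCommMonoid M] (L : ℕ) (a : ℕ → M)
    (ha : ∀ r, 2 * r + 1 ≤ L → a (2 * r + 1) = 0) :
    ∑ m ∈ Finset.range (L + 1), a m =
      ∑ j ∈ Finset.range (L + 1), if 2 * j ≤ L then a (2 * j) else 0 := by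
  rw [← Finset.sum_filter, ← Finset.sum_image (f := a) (g := fun j => 2 * j)
    (fun x _ y _ h => by simpa using h)]
  symm
  refine Finset.sum_subset ?_ ?_
  · intro m hm
    simp only [Finset.mem_image, Finset.mem_filter, Finset.mem_range] at hm ⊢
    omega
  · intro m hm hm'
    simp only [Finset.mem_image, Finset.mem_filter, Finset.mem_range, not_exists, not_and] at hm hm'
    rcases Nat.even_or_odd' m with ⟨r, rfl | rfl⟩
    · exact absurd rfl (hm' r (by omega))
    · exact ha r (by omega)

theorem mainTheorem3 {R : Type*} [CommRing R] [Algebra ℚ R] (q z : R) (L : ℕ) :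
    (Function.support fun p : ℕ × ℕ =>
      q ^ (triangular p.1 + triangular p.2) * (-z ^ 2) ^ p.2 *
        qBinomial q ((L : ℤ) - p.2) p.1 * qBinomial q p.1 p.2).Finite ∧
    (Function.support fun p : ℕ × ℕ × ℕ =>
      (-1) ^ p.2.1 * z ^ (p.1 + p.2.1) *
        q ^ (triangular p.1 + triangular p.2.1 + triangular p.2.2) *
        qBinomial q ((L : ℤ) - p.1) p.2.1 * qBinomial q ((L : ℤ) - p.2.1) p.2.2 *
        qBinomial q ((L : ℤ) - p.2.2) p.1).Finite ∧
    (∑ᶠ p : ℕ × ℕ,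
      q ^ (triangular p.1 + triangular p.2) * (-z ^ 2) ^ p.2 *
        qBinomial q ((L : ℤ) - p.2) p.1 * qBinomial q p.1 p.2) =
    ∑ᶠ p : ℕ × ℕ × ℕ,
      (-1) ^ p.2.1 * z ^ (p.1 + p.2.1) *
        q ^ (triangular p.1 + triangular p.2.1 + triangular p.2.2) *
        qBinomial q ((L : ℤ) - p.1) p.2.1 * qBinomial q ((L : ℤ) - p.2.1) p.2.2 *
        qBinomial q ((L : ℤ) - p.2.2) p.1 := by
  simp only [qBinomial_natCast, qBinomial_natCast_sub]
  have hl : (Function.support fun p : ℕ × ℕ =>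
      q ^ (triangular p.1 + triangular p.2) * (-z ^ 2) ^ p.2 *
        (if p.2 ≤ L then gaussBinom q (L - p.2) p.1 else 0) * gaussBinom q p.1 p.2) ⊆
      ((Finset.range (L + 1) ×ˢ Finset.range (L + 1) : Finset (ℕ × ℕ)) : Set (ℕ × ℕ)) := by
    rintro ⟨i, j⟩ h
    simp only [Finset.coe_product, Finset.coe_range, Set.mem_prod, Set.mem_Iio]
    contrapose! h
    rw [Function.notMem_support]
    dsimp only
    split_ifs with hj
    · have hi : L - j < i := by
        by_contra hc
        exact absurd (h (by omega)) (by omega)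
      rw [gaussBinom_eq_zero_of_lt q hi]
      simp
    · simp
  have hr : (Function.support fun p : ℕ × ℕ × ℕ =>
      (-1) ^ p.2.1 * z ^ (p.1 + p.2.1) *
        q ^ (triangular p.1 + triangular p.2.1 + triangular p.2.2) *
        (if p.1 ≤ L then gaussBinom q (L - p.1) p.2.1 else 0) *
        (if p.2.1 ≤ L then gaussBinom q (L - p.2.1) p.2.2 else 0) *
        (if p.2.2 ≤ L then gaussBinom q (L - p.2.2) p.1 else 0)) ⊆
      ((Finset.range (L + 1) ×ˢ Finset.range (L + 1) ×ˢ Finset.range (L + 1) :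
        Finset (ℕ × ℕ × ℕ)) : Set (ℕ × ℕ × ℕ)) := by
    rintro ⟨i, j, k⟩ h
    simp only [Finset.coe_product, Finset.coe_range, Set.mem_prod, Set.mem_Iio]
    contrapose! h
    rw [Function.notMem_support]
    dsimp only
    split_ifs with h1 h2 h3 <;> first | simp | skip
    exact absurd (h (by omega) (by omega)) (by omega)
  refine ⟨(Finset.finite_toSet _).subset hl, (Finset.finite_toSet _).subset hr, ?_⟩
  rw [finsum_eq_sum_of_support_subset _ hl, finsum_eq_sum_of_support_subset _ hr,
    Finset.sum_product_right, Finset.sum_product]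
  simp only [Finset.sum_product]
  have e1 : ∀ i ∈ Finset.range (L + 1), ∀ j ∈ Finset.range (L + 1),
      ∑ k ∈ Finset.range (L + 1), (-1) ^ j * z ^ (i + j) *
        q ^ (triangular i + triangular j + triangular k) *
        (if i ≤ L then gaussBinom q (L - i) j else 0) *
        (if j ≤ L then gaussBinom q (L - j) k else 0) *
        (if k ≤ L then gaussBinom q (L - k) i else 0) =
      z ^ (i + j) * ∑ k ∈ Finset.range (L + 1),
        (-1) ^ j * q ^ (triangular i + triangular j + triangular k) *
        gaussBinom q (L - i) j * gaussBinom q (L - j) k * gaussBinom q (L - k) i := by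
    intro i hi j hj
    rw [Finset.mul_sum]
    refine Finset.sum_congr rfl fun k hk => ?_
    rw [Finset.mem_range] at hi hj hk
    rw [if_pos (by omega), if_pos (by omega), if_pos (by omega)]
    ring
  rw [Finset.sum_congr rfl fun i hi => Finset.sum_congr rfl (e1 i hi)]
  -- The factor `[L-i; j]` kills all terms with `i + j > L`, so the square can be summed along its
  -- antidiagonals.
  have e2 : ∀ i ∈ Finset.range (L + 1), ∀ j ∈ Finset.range (L + 1),
      (z ^ (i + j) * ∑ k ∈ Finset.range (L + 1),
        (-1) ^ j * q ^ (triangular i + triangular j + triangular k) *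
        gaussBinom q (L - i) j * gaussBinom q (L - j) k * gaussBinom q (L - k) i) =
      if i + j ≤ L then z ^ (i + j) * ∑ k ∈ Finset.range (L + 1),
        (-1) ^ j * q ^ (triangular i + triangular j + triangular k) *
        gaussBinom q (L - i) j * gaussBinom q (L - j) k * gaussBinom q (L - k) i else 0 := by
    intro i hi j _
    split_ifs with h
    · rfl
    · rw [Finset.mem_range] at hi
      rw [gaussBinom_eq_zero_of_lt q (show L - i < j by omega)]
      simp
  rw [Finset.sum_congr rfl fun i hi => Finset.sum_congr rfl (e2 i hi),
    sum_range_sum_range_eq_sum_antidiagonal L _ fun i j h => if_neg (by omega)]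
  have e3 : ∀ m ∈ Finset.range (L + 1), ∑ p ∈ Finset.HasAntidiagonal.antidiagonal m,
      (if p.1 + p.2 ≤ L then z ^ (p.1 + p.2) * ∑ k ∈ Finset.range (L + 1),
        (-1) ^ p.2 * q ^ (triangular p.1 + triangular p.2 + triangular k) *
        gaussBinom q (L - p.1) p.2 * gaussBinom q (L - p.2) k * gaussBinom q (L - k) p.1 else 0) =
      z ^ m * ∑ p ∈ Finset.HasAntidiagonal.antidiagonal m, ∑ k ∈ Finset.range (L + 1),
        (-1) ^ p.2 * q ^ (triangular p.1 + triangular p.2 + triangular k) *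
        gaussBinom q (L - p.1) p.2 * gaussBinom q (L - p.2) k * gaussBinom q (L - k) p.1 := by
    intro m hm
    rw [Finset.mul_sum]
    refine Finset.sum_congr rfl fun p hp => ?_
    rw [Finset.HasAntidiagonal.mem_antidiagonal] at hp
    rw [Finset.mem_range] at hm
    rw [if_pos (by omega), hp]
  rw [Finset.sum_congr rfl e3]
  refine Eq.trans ?_ (sum_range_eq_sum_even L _ ?_).symm
  · refine Finset.sum_congr rfl fun j hj => ?_
    rw [Finset.mem_range] at hj
    split_ifs with h1 h2 h2
    · obtain ⟨d, rfl⟩ := Nat.exists_eq_add_of_le h2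
      rw [sum_cyclic_even, show 2 * j + d - j = j + d by omega, ← mul_assoc, Finset.mul_sum]
      refine Finset.sum_congr rfl fun i _ => ?_
      rw [neg_pow (z ^ 2), ← pow_mul]
      ring
    -- A nonzero term would need `j ≤ i ≤ L - j`, contrary to `2 * j > L`.
    · refine Finset.sum_eq_zero fun i _ => ?_
      rcases Nat.lt_or_ge i j with h | h
      · rw [gaussBinom_eq_zero_of_lt q h, mul_zero]
      · rw [gaussBinom_eq_zero_of_lt q (show L - j < i by omega)]
        simp
    · omega
    · simp
  · intro r hr
    obtain ⟨d, rfl⟩ := Nat.exists_eq_add_of_le hr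
    rw [sum_cyclic_odd, mul_zero]
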